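/- Let $(M,g_M)$ be an $n$-dimensional closed Riemannian manifold, $I\subset\mathbb R$ an open interval, $r\colon I\to(0,\infty)$ a smooth function, and let ${}_rM\times I$ be the warped product, i.e. the manifold $\overline M=M\times I$ with the metric $\overline g=r(z)^2\,\pi_M^*g_M+dz\otimes dz$, where $\pi_M$ is the projection onto $M$ and $z$ the coordinate of $I$. Let $u\colon M\to I$ be smooth, $f\colon M\to\overline M$, $f(p)=(p,u(p))$, its graph map, and $w=\sqrt{(r\circ u)^2+|\mathrm{grad}\,u|^2}$, where $\mathrm{grad}$, $|\cdot|$ and the Laplacian $\Delta^M=\mathrm{div}\,\mathrm{grad}$ are those of $g_M$. Then $$N=\frac1w\Bigl(-\frac1{r\circ u}(\mathrm{grad}\,u)^L+(r\circ u)\,\partial_z\Bigr)$$ (where $X^L$ denotes the lift to $\overline M$ of a tangent vector $X$ of $M$) is a smooth unit normal vector field along $f$ with $dz(N)>0$, and the mean curvature $H$ of the graph with respect to $-N$, that is, the trace with respect to the induced metric $f^*\overline g$ of the second fundamental form $h(X,Y)=\overline g(\overline\nabla^f_XN,df(Y))$, where $\overline\nabla^f$ is the pullback by $f$ of the Levi-Civita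 connection of $\overline g$, is $$H=-\frac{1}{(r\circ u)\,w}\Delta^Mu+\frac{1}{2(r\circ u)\,w^3}\,g_M\bigl(\mathrm{grad}(|\mathrm{grad}\,u|^2),\mathrm{grad}\,u\bigr)+\frac{r'\circ u}{w^3}|\mathrm{grad}\,u|^2+n\,\frac{r'\circ u}{w}.$$ -/

import Mathlib

set_option maxSynthPendingDepth 3

open Manifold
open scoped ContDiff

noncomputable section

namespace WarpedGraph

section General

variable {E : Type*} [NormedAddCommGroup E] [NormedSpace ℝ E]
  {H : Type*} [TopologicalSpace H] {I : ModelWithCorners ℝ E H}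
  {M : Type*} [TopologicalSpace M] [ChartedSpace H M]
  {E' : Type*} [NormedAddCommGroup E'] [NormedSpace ℝ E']
  {H' : Type*} [TopologicalSpace H'] {I' : ModelWithCorners ℝ E' H'}
  {N : Type*} [TopologicalSpace N] [ChartedSpace H' N]

/-- The trace `B^{ij} h_{ij}` of a bilinear form `h` with respect to an inner product `B` on a
finite-dimensional space: the trace of the endomorphism `A` with `B (A v) w = h v w`. -/
def metricTrace (B h : E →L[ℝ] E →L[ℝ] ℝ) : ℝ :=
  LinearMap.trace ℝ E ((B.inverse ∘L h : E →L[ℝ] E) : E →ₗ[ℝ] E)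

/-- The bilinear form `(v, w) ↦ G (A v) (B w)`. -/
def pullForm (G : E' →L[ℝ] E' →L[ℝ] ℝ) (A B : E →L[ℝ] E') : E →L[ℝ] E →L[ℝ] ℝ :=
  G.bilinearComp A B

/-- For a trilinear form `D`, the form `(v, w, z) ↦ (D v w z + D w v z - D z v w) / 2`. -/
def koszulForm (D : E →L[ℝ] (E →L[ℝ] E →L[ℝ] ℝ)) : E →L[ℝ] (E →L[ℝ] E →L[ℝ] ℝ) :=
  letI K : E →L[ℝ] (E →L[ℝ] E →L[ℝ] ℝ) :=
    (ContinuousLinearMap.flipₗᵢ ℝ E E ℝ).toContinuousLinearEquiv.toContinuousLinearMap ∘L D.flip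
  (1 / 2 : ℝ) • (D + D.flip - K)

/-- The gradient of a real function: `g (grad u) v = du v` for all `v`. -/
def grad (g : Π x : M, TangentSpace I x →L[ℝ] TangentSpace I x →L[ℝ] ℝ) (u : M → ℝ) (p : M) :
    TangentSpace I p :=
  (g p).inverse (mfderiv I 𝓘(ℝ, ℝ) u p)

/-- The pullback of a metric under a map, `(f^* g) v w = g (df v) (df w)`. -/
def inducedMetric (g : Π x : N, TangentSpace I' x →L[ℝ] TangentSpace I' x →L[ℝ] ℝ) (f : M → N)
    (p : M) : TangentSpace I p →L[ℝ] TangentSpace I p →L[ℝ] ℝ :=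
  pullForm (E := E) (E' := E') (g (f p)) (mfderiv I I' f p) (mfderiv I I' f p)

variable [IsManifold I 1 M] [IsManifold I' 1 N]

/-- The coefficients `g_{ij}` of a metric, as a function of `q`, in the coordinate frame of the
chart at `x`. -/
def metricCoeff (g : Π x : M, TangentSpace I x →L[ℝ] TangentSpace I x →L[ℝ] ℝ) (x q : M) :
    E →L[ℝ] E →L[ℝ] ℝ :=
  letI A : E →L[ℝ] E := (trivializationAt E (TangentSpace I : M → Type _) x).symmL ℝ q
  pullForm (E := E) (E' := E) (g q) A A

/-- The derivative at `x` of the metric coefficients in the chart at `x`: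
`dMetricCoeff g x v w z = v (g (w, z))` for constant coordinate fields `w`, `z`. -/
def dMetricCoeff (g : Π x : M, TangentSpace I x →L[ℝ] TangentSpace I x →L[ℝ] ℝ) (x : M) :
    E →L[ℝ] E →L[ℝ] E →L[ℝ] ℝ :=
  mfderiv I 𝓘(ℝ, E →L[ℝ] E →L[ℝ] ℝ) (metricCoeff g x) x

/-- Christoffel symbols of the first kind at `x` in the chart at `x`:
`(v (g (w, z)) + w (g (v, z)) - z (g (v, w))) / 2`. -/
def christoffelLower (g : Π x : M, TangentSpace I x →L[ℝ] TangentSpace I x →L[ℝ] ℝ) (x : M) :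
    E →L[ℝ] E →L[ℝ] E →L[ℝ] ℝ :=
  koszulForm (dMetricCoeff g x)

/-- Christoffel symbols of the Levi-Civita connection at `x` in the chart at `x`. -/
def christoffel (g : Π x : M, TangentSpace I x →L[ℝ] TangentSpace I x →L[ℝ] ℝ) (x : M) :
    E →L[ℝ] E →L[ℝ] E :=
  letI sharp : (E →L[ℝ] ℝ) →L[ℝ] E := ContinuousLinearMap.inverse (g x : E →L[ℝ] E →L[ℝ] ℝ)
  (ContinuousLinearMap.compL ℝ E (E →L[ℝ] ℝ) E sharp) ∘L christoffelLower g x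

/-- The pullback by `f : M → N` of the Levi-Civita connection of the metric `g` on `N`, applied to
a vector field `V` along `f`: `(∇^f_v V) = dV(v) + Γ (df v) V`, computed at `p` in the chart of `N`
at `f p`. The tangent space at `f p` is identified with the model space by that same chart. -/
def covDerivAlong (g : Π x : N, TangentSpace I' x →L[ℝ] TangentSpace I' x →L[ℝ] ℝ) (f : M → N)
    (V : Π q : M, TangentSpace I' (f q)) (p : M) :
    TangentSpace I p →L[ℝ] TangentSpace I' (f p) :=
  letI dV : E →L[ℝ] E' := mfderiv I 𝓘(ℝ, E')
    (fun q ↦ (trivializationAt E' (TangentSpace I' : N → Type _) (f p) ⟨f q, V q⟩).2) p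
  letI df : E →L[ℝ] E' := mfderiv I I' f p
  letI Vp : E' := V p
  dV + (christoffel g (f p)).flip Vp ∘L df

/-- The Laplacian `Δ u = div (grad u) = tr (∇ grad u)`. -/
def laplacian (g : Π x : M, TangentSpace I x →L[ℝ] TangentSpace I x →L[ℝ] ℝ) (u : M → ℝ) (p : M) :
    ℝ :=
  letI A : E →L[ℝ] E := covDerivAlong (I := I) g (fun q : M ↦ q) (grad g u) p
  LinearMap.trace ℝ E (A : E →ₗ[ℝ] E)

/-- `ν` is a smooth unit normal vector field along `f`. -/
structure IsUnitNormalAlong (I : ModelWithCorners ℝ E H)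
    (g : Π x : N, TangentSpace I' x →L[ℝ] TangentSpace I' x →L[ℝ] ℝ) (f : M → N)
    (ν : Π q : M, TangentSpace I' (f q)) : Prop where
  contMDiff : ContMDiff I I'.tangent ∞ (fun q ↦ (⟨f q, ν q⟩ : TangentBundle I' N))
  unit : ∀ p, g (f p) (ν p) (ν p) = 1
  normal : ∀ (p : M) (v : TangentSpace I p), g (f p) (ν p) (mfderiv I I' f p v) = 0

/-- The second fundamental form of `f : M → N` with respect to the unit normal `ν`,
`h v w = - g (∇^f_v ν) (df w)`. -/
def secondFundamentalForm (g : Π x : N, TangentSpace I' x →L[ℝ] TangentSpace I' x →L[ℝ] ℝ)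
    (f : M → N) (ν : Π q : M, TangentSpace I' (f q)) (p : M) :
    TangentSpace I p →L[ℝ] TangentSpace I p →L[ℝ] ℝ :=
  letI h : E →L[ℝ] E →L[ℝ] ℝ :=
    pullForm (E := E) (E' := E') (g (f p)) (covDerivAlong (I := I) g f ν p) (mfderiv I I' f p)
  (-h : E →L[ℝ] E →L[ℝ] ℝ)

/-- The mean curvature of `f : M → N` with respect to the unit normal `ν`: the trace of the second
fundamental form with respect to the induced metric (the sum of the principal curvatures). -/
def meanCurvature (I : ModelWithCorners ℝ E H) [IsManifold I 1 M]
    (g : Π x : N, TangentSpace I' x →L[ℝ] TangentSpace I' x →L[ℝ] ℝ)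
    (f : M → N) (ν : Π q : M, TangentSpace I' (f q)) (p : M) : ℝ :=
  metricTrace (E := E) (inducedMetric (I := I) g f p) (secondFundamentalForm (I := I) g f ν p)

end General

section Warped

variable {E : Type*} [NormedAddCommGroup E] [NormedSpace ℝ E]
  {M : Type*} [TopologicalSpace M] [ChartedSpace E M] {J : TopologicalSpace.Opens ℝ}

/-- The differential `dz` of the coordinate `z` of the second factor of `M × J`. -/
def dz (x : M × J) : TangentSpace (𝓘(ℝ, E).prod 𝓘(ℝ, ℝ)) x →L[ℝ] ℝ :=
  mfderiv (𝓘(ℝ, E).prod 𝓘(ℝ, ℝ)) 𝓘(ℝ, ℝ) (fun y : M × J ↦ (y.2 : ℝ)) x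

/-- The warped product metric `r(z)^2 π_M^* g + dz ⊗ dz` on `M × J`. -/
def warpedMetric (g : Π x : M, TangentSpace 𝓘(ℝ, E) x →L[ℝ] TangentSpace 𝓘(ℝ, E) x →L[ℝ] ℝ)
    (r : ℝ → ℝ) (x : M × J) :
    TangentSpace (𝓘(ℝ, E).prod 𝓘(ℝ, ℝ)) x →L[ℝ]
      TangentSpace (𝓘(ℝ, E).prod 𝓘(ℝ, ℝ)) x →L[ℝ] ℝ :=
  letI dπ : E × ℝ →L[ℝ] E :=
    mfderiv (𝓘(ℝ, E).prod 𝓘(ℝ, ℝ)) 𝓘(ℝ, E) (Prod.fst : M × J → M) x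
  letI ζ : E × ℝ →L[ℝ] ℝ := dz (E := E) x
  r x.2 ^ 2 • pullForm (E := E × ℝ) (E' := E) (g x.1) dπ dπ + ζ.smulRight ζ

/-- The graph map `p ↦ (p, u p)`. -/
def graphMap (u : M → J) (p : M) : M × J := (p, u p)

/-- `|grad u|^2`. -/
def gradSq (g : Π x : M, TangentSpace 𝓘(ℝ, E) x →L[ℝ] TangentSpace 𝓘(ℝ, E) x →L[ℝ] ℝ)
    (u : M → ℝ) (p : M) : ℝ :=
  g p (grad g u p) (grad g u p)

/-- `w = √(r(u)^2 + |grad u|^2)`. -/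
def graphW (g : Π x : M, TangentSpace 𝓘(ℝ, E) x →L[ℝ] TangentSpace 𝓘(ℝ, E) x →L[ℝ] ℝ)
    (r : ℝ → ℝ) (u : M → J) (p : M) : ℝ :=
  √(r (u p) ^ 2 + gradSq g (fun q ↦ (u q : ℝ)) p)

/-- The upward normal field `N = w⁻¹ (- r(u)⁻¹ (grad u)^L + r(u) ∂_z)` along the graph map; the
tangent space of `M × J` at `(p, z)` is the product of `T_p M` and `T_z J = ℝ`. -/
def graphNormal (g : Π x : M, TangentSpace 𝓘(ℝ, E) x →L[ℝ] TangentSpace 𝓘(ℝ, E) x →L[ℝ] ℝ)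
    (r : ℝ → ℝ) (u : M → J) (p : M) :
    TangentSpace (𝓘(ℝ, E).prod 𝓘(ℝ, ℝ)) (graphMap u p) :=
  letI X : E := grad g (fun q ↦ (u q : ℝ)) p
  ((-(1 / (r (u p) * graphW g r u p)) • X, r (u p) / graphW g r u p) : E × ℝ)

end Warped

end WarpedGraph

end

/-!
Up to the positive factor `1 / (r(u) w)`, the normal `-N` is `ξ = grad u - r(u)² ∂_z`. The
derivative of the factor only contributes normal terms, so it suffices to compute the second
fundamental form of `ξ`. O'Neill's formulas for the connection of the warped product express it as
`g_M (A v, w)` with `A = -r² Hess u + 2 r r' du ⊗ grad u + r³ r' id`, while the induced metric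
`r² g_M + du ⊗ du` is a rank-one perturbation of a multiple of `g_M`, which the Sherman–Morrison
formula inverts. Taking the trace gives the mean curvature.
-/

namespace WarpedGraph

section LinearAlgebra

variable {E : Type*} [NormedAddCommGroup E] [NormedSpace ℝ E]

theorem koszulForm_apply (D : E →L[ℝ] E →L[ℝ] E →L[ℝ] ℝ) (v w z : E) :
    koszulForm D v w z = 1 / 2 * (D v w z + D w v z - D z v w) := rfl

theorem koszulForm_add_koszulForm_swap {D : E →L[ℝ] E →L[ℝ] E →L[ℝ] ℝ}
    (hD : ∀ v w z, D v w z = D v z w) (v w z : E) :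
    koszulForm D v w z + koszulForm D v z w = D v w z := by
  rw [koszulForm_apply, koszulForm_apply, hD v z w, hD w v z, hD z v w]
  ring

theorem isInvertible_of_pos [FiniteDimensional ℝ E] {B : E →L[ℝ] E →L[ℝ] ℝ}
    (hB : ∀ v, v ≠ 0 → 0 < B v v) : B.IsInvertible := by
  have hinj : Function.Injective (B : E →ₗ[ℝ] E →L[ℝ] ℝ) := by
    refine (injective_iff_map_eq_zero _).2 fun v hv ↦ by_contra fun h ↦ (hB v h).ne' ?_
    exact congrArg (fun φ : E →L[ℝ] ℝ ↦ φ v) hv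
  have hdim : Module.finrank ℝ E = Module.finrank ℝ (E →L[ℝ] ℝ) :=
    (LinearMap.toContinuousLinearMap (𝕜 := ℝ) (E := E) (F' := ℝ)).finrank_eq ▸
      (Subspace.dual_finrank_eq (K := ℝ) (V := E)).symm
  exact ⟨(LinearEquiv.ofInjectiveOfFinrankEq _ hinj hdim).toContinuousLinearEquiv, rfl⟩

theorem metricTrace_smul (B h : E →L[ℝ] E →L[ℝ] ℝ) (c : ℝ) :
    metricTrace B (c • h) = c * metricTrace B h := by
  rw [metricTrace, ContinuousLinearMap.comp_smul, ContinuousLinearMap.toLinearMap_smul, map_smul,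
    smul_eq_mul, metricTrace]

/- The Sherman–Morrison formula. -/
theorem inverse_smul_add_smulRight_comp {G : E →L[ℝ] E →L[ℝ] ℝ} (hG : G.IsInvertible) (X : E)
    {s : ℝ} (hs : s ≠ 0) (hsX : s + G X X ≠ 0) :
    (s • G + (G X).smulRight (G X)).inverse ∘L G =
      s⁻¹ • (.id ℝ E - (s + G X X)⁻¹ • (G X).smulRight X) := by
  let S : E →L[ℝ] E := s • .id ℝ E + (G X).smulRight X
  let R : E →L[ℝ] E := s⁻¹ • (.id ℝ E - (s + G X X)⁻¹ • (G X).smulRight X)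
  have hS : s • G + (G X).smulRight (G X) = G ∘L S := by
    ext v w
    simp [S]
  have hSR : S ∘L R = .id ℝ E := by
    ext v
    simp only [S, R, ContinuousLinearMap.comp_apply, _root_.add_apply, _root_.smul_apply,
      _root_.sub_apply, ContinuousLinearMap.id_apply, ContinuousLinearMap.smulRight_apply,
      map_smul, map_sub]
    match_scalars <;> field_simp
    ring
  have hRS : R ∘L S = .id ℝ E := by
    ext v
    simp only [S, R, ContinuousLinearMap.comp_apply, _root_.add_apply, _root_.smul_apply,
      _root_.sub_apply, ContinuousLinearMap.id_apply, ContinuousLinearMap.smulRight_apply,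
      map_smul, map_add]
    match_scalars <;> field_simp
    ring
  rw [hS, hG.inverse_comp_of_left, ContinuousLinearMap.inverse_eq hSR hRS]
  ext v
  simp [R, hG.inverse_apply_self]

theorem metricTrace_smul_add_smulRight_comp [FiniteDimensional ℝ E] {G : E →L[ℝ] E →L[ℝ] ℝ}
    (hG : G.IsInvertible) (X : E) {s : ℝ} (hs : s ≠ 0) (hsX : s + G X X ≠ 0) (A : E →L[ℝ] E) :
    metricTrace (s • G + (G X).smulRight (G X)) (G ∘L A) =
      s⁻¹ * (LinearMap.trace ℝ E A - G X (A X) / (s + G X X)) := by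
  have hA : (((s⁻¹ • (.id ℝ E - (s + G X X)⁻¹ • (G X).smulRight X)) ∘L A : E →L[ℝ] E) :
      E →ₗ[ℝ] E) = s⁻¹ • ((A : E →ₗ[ℝ] E) -
        (s + G X X)⁻¹ • ((G X ∘L A : E →L[ℝ] ℝ) : E →ₗ[ℝ] ℝ).smulRight X) := by
    ext v
    simp
  rw [metricTrace, ← ContinuousLinearMap.comp_assoc, inverse_smul_add_smulRight_comp hG X hs hsX,
    hA, map_smul, map_sub, map_smul, LinearMap.trace_smulRight, smul_eq_mul, smul_eq_mul,
    div_eq_inv_mul]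
  rfl

theorem metricTrace_smul_add_smulRight_comp_add [FiniteDimensional ℝ E] {G : E →L[ℝ] E →L[ℝ] ℝ}
    (hG : G.IsInvertible) (X : E) {s : ℝ} (hs : s ≠ 0) (hsX : s + G X X ≠ 0) (A : E →L[ℝ] E)
    (a b c : ℝ) :
    metricTrace (s • G + (G X).smulRight (G X))
        (G ∘L (a • A + b • (G X).smulRight X + c • .id ℝ E)) =
      s⁻¹ * (a * (LinearMap.trace ℝ E A - G X (A X) / (s + G X X)) +
        b * s * (G X X / (s + G X X)) + c * (Module.finrank ℝ E - G X X / (s + G X X))) := by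
  have htrace : LinearMap.trace ℝ E
      ((a • A + b • (G X).smulRight X + c • .id ℝ E : E →L[ℝ] E) : E →ₗ[ℝ] E) =
      a * LinearMap.trace ℝ E A + b * G X X + c * Module.finrank ℝ E := by
    have h : ((a • A + b • (G X).smulRight X + c • .id ℝ E : E →L[ℝ] E) : E →ₗ[ℝ] E) =
        a • (A : E →ₗ[ℝ] E) + b • (G X : E →ₗ[ℝ] ℝ).smulRight X + c • LinearMap.id := rfl
    rw [h, map_add, map_add, map_smul, map_smul, map_smul, LinearMap.trace_smulRight,
      LinearMap.trace_id]
    rfl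
  rw [metricTrace_smul_add_smulRight_comp hG X hs hsX, htrace]
  simp only [_root_.add_apply, _root_.smul_apply, ContinuousLinearMap.smulRight_apply,
    ContinuousLinearMap.id_apply, map_add, map_smul, smul_eq_mul]
  field_simp
  ring

end LinearAlgebra

section ChartCoordinates

variable {E : Type*} [NormedAddCommGroup E] [NormedSpace ℝ E]
  {H : Type*} [TopologicalSpace H] {I : ModelWithCorners ℝ E H}
  {M : Type*} [TopologicalSpace M] [ChartedSpace H M] [IsManifold I 1 M]

/-- The coordinates of a tangent vector in the coordinate frame of the chart at `x`. -/
noncomputable def tangentCoord (x : M) {q : M} (v : TangentSpace I q) : E :=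
  (trivializationAt E (TangentSpace I : M → Type _) x ⟨q, v⟩).2

theorem tangentCoord_self (x : M) (v : TangentSpace I x) :
    tangentCoord x v = v :=
  tangentCoordChange_self (mem_extChartAt_source x)

theorem symmL_tangentCoord {x q : M} (hq : q ∈ (chartAt H x).source)
    (v : TangentSpace I q) :
    (trivializationAt E (TangentSpace I : M → Type _) x).symmL ℝ q
      (tangentCoord x v) = v := by
  rw [tangentCoord, ← Bundle.Trivialization.continuousLinearMapAt_apply_of_mem ℝ _ hq v,
    Bundle.Trivialization.symmL_continuousLinearMapAt _ hq]

theorem tangentCoord_symmL {x q : M} (hq : q ∈ (chartAt H x).source) (v : E) :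
    tangentCoord x ((trivializationAt E (TangentSpace I : M → Type _) x).symmL ℝ q v) = v := by
  rw [tangentCoord, ← Bundle.Trivialization.continuousLinearMapAt_apply_of_mem ℝ _ hq,
    Bundle.Trivialization.continuousLinearMapAt_symmL _ hq]

theorem metricCoeff_apply (g : Π x : M, TangentSpace I x →L[ℝ] TangentSpace I x →L[ℝ] ℝ)
    (x q : M) (v w : E) :
    metricCoeff g x q v w =
      g q ((trivializationAt E (TangentSpace I : M → Type _) x).symmL ℝ q v)
        ((trivializationAt E (TangentSpace I : M → Type _) x).symmL ℝ q w) :=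
  rfl

theorem metricCoeff_tangentCoord
    (g : Π x : M, TangentSpace I x →L[ℝ] TangentSpace I x →L[ℝ] ℝ) {x q : M}
    (hq : q ∈ (chartAt H x).source) (v w : TangentSpace I q) :
    metricCoeff g x q (tangentCoord x v) (tangentCoord x w) = g q v w := by
  rw [metricCoeff_apply, symmL_tangentCoord hq, symmL_tangentCoord hq]

theorem metricCoeff_self (g : Π x : M, TangentSpace I x →L[ℝ] TangentSpace I x →L[ℝ] ℝ) (x : M) :
    metricCoeff g x x = g x := by
  refine ContinuousLinearMap.ext fun v ↦ ContinuousLinearMap.ext fun w ↦ ?_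
  have h := metricCoeff_tangentCoord g (mem_chart_source H x) v w
  rwa [tangentCoord_self (I := I) x v, tangentCoord_self (I := I) x w] at h

theorem contMDiffAt_metricCoeff {n : ℕ∞ω}
    (g : Bundle.ContMDiffRiemannianMetric I n E (fun x : M ↦ TangentSpace I x)) (x : M) :
    ContMDiffAt I 𝓘(ℝ, E →L[ℝ] E →L[ℝ] ℝ) n (metricCoeff g.inner x) x := by
  refine ((contMDiffAt_hom_bundle _).1 (g.contMDiff x)).2.congr_of_eventuallyEq ?_
  filter_upwards [chart_source_mem_nhds H x] with q hq
  have hb : q ∈ (trivializationAt E (TangentSpace I : M → Type _) x).baseSet := hq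
  have htriv (t : ℝ) : (trivializationAt ℝ (Bundle.Trivial M ℝ) x).linearMapAt ℝ q t = t :=
    congrArg (fun A : ℝ →ₗ[ℝ] ℝ ↦ A t) (Bundle.Trivial.linearMapAt_trivialization ℝ M ℝ q)
  ext v w
  refine Eq.trans ?_ (inCoordinates_apply_eq₂ hb hb (Set.mem_univ _)).symm
  rw [metricCoeff_apply, Bundle.Trivialization.symmL_apply _ hb,
    Bundle.Trivialization.symmL_apply _ hb]
  exact (htriv _).symm

variable {n : ℕ∞ω} [FiniteDimensional ℝ E]
  (g : Bundle.ContMDiffRiemannianMetric I n E (fun x : M ↦ TangentSpace I x))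

theorem isInvertible_inner (p : M) : (g.inner p).IsInvertible :=
  isInvertible_of_pos (E := E) (g.pos p)

theorem isInvertible_metricCoeff {x q : M} (hq : q ∈ (chartAt H x).source) :
    (metricCoeff g.inner x q).IsInvertible := by
  refine isInvertible_of_pos fun v hv ↦ g.pos q _ fun h ↦ hv ?_
  rw [← tangentCoord_symmL (I := I) hq v]
  exact (congrArg _ h).trans
    ((trivializationAt E (TangentSpace I : M → Type _) x).linear ℝ hq).map_zero

end ChartCoordinates

section CovariantDerivative

variable {E : Type*} [NormedAddCommGroup E] [NormedSpace ℝ E]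
  {H : Type*} [TopologicalSpace H] {I : ModelWithCorners ℝ E H}
  {M : Type*} [TopologicalSpace M] [ChartedSpace H M]
  {V W : Type*} [NormedAddCommGroup V] [NormedSpace ℝ V] [NormedAddCommGroup W] [NormedSpace ℝ W]

theorem mvfderiv_congr {F G : M → V} {p : M} (h : F =ᶠ[nhds p] G) :
    mvfderiv I F p = mvfderiv I G p :=
  h.mfderiv_eq

theorem mvfderiv_fderiv_comp {F : M → V} {p : M} {Φ : V → W} (hΦ : DifferentiableAt ℝ Φ (F p))
    (hF : MDifferentiableAt I 𝓘(ℝ, V) F p) (v : TangentSpace I p) :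
    mvfderiv I (fun q ↦ Φ (F q)) p v = fderiv ℝ Φ (F p) (mvfderiv I F p v) :=
  (mfderiv_comp_apply p hΦ.mdifferentiableAt hF v).trans
    (congrArg (fun B : V →L[ℝ] W ↦ B (mvfderiv I F p v)) mfderiv_eq_fderiv)

theorem mvfderiv_prodMk {F : M → V} {G : M → W} {p : M} (hF : MDifferentiableAt I 𝓘(ℝ, V) F p)
    (hG : MDifferentiableAt I 𝓘(ℝ, W) G p) (v : TangentSpace I p) :
    mvfderiv I (fun q ↦ (F q, G q)) p v = (mvfderiv I F p v, mvfderiv I G p v) := by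
  have h : HasMFDerivAt I 𝓘(ℝ, V × W) (fun q ↦ (F q, G q)) p
      ((mvfderiv I F p : E →L[ℝ] V).prod (mvfderiv I G p : E →L[ℝ] W)) :=
    ⟨hF.continuousAt.prodMk hG.continuousAt, hF.hasMFDerivAt.2.prodMk hG.hasMFDerivAt.2⟩
  exact congrArg (fun B : E →L[ℝ] V × W ↦ B v) h.mfderiv

theorem mvfderiv_clm_apply {A : M → V →L[ℝ] W} {F : M → V} {p : M}
    (hA : MDifferentiableAt I 𝓘(ℝ, V →L[ℝ] W) A p) (hF : MDifferentiableAt I 𝓘(ℝ, V) F p)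
    (v : TangentSpace I p) :
    mvfderiv I (fun q ↦ A q (F q)) p v = mvfderiv I A p v (F p) + A p (mvfderiv I F p v) := by
  have hev : HasFDerivAt (fun x : (V →L[ℝ] W) × V ↦ x.1 x.2) _ (A p, F p) :=
    hasFDerivAt_fst.clm_apply hasFDerivAt_snd
  rw [mvfderiv_fderiv_comp (F := fun q ↦ (A q, F q)) hev.differentiableAt (hA.prodMk_space hF),
    hev.fderiv, mvfderiv_prodMk hA hF]
  simp [add_comm]

variable {E' : Type*} [NormedAddCommGroup E'] [NormedSpace ℝ E']
  {H' : Type*} [TopologicalSpace H'] {I' : ModelWithCorners ℝ E' H'}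
  {N : Type*} [TopologicalSpace N] [ChartedSpace H' N]

theorem mvfderiv_comp_fst {F : M → W} {x : M × N} (hF : MDifferentiableAt I 𝓘(ℝ, W) F x.1) (v : E)
    (w : E') :
    mvfderiv (I.prod I') (fun y : M × N ↦ F y.1) x ((v, w) : E × E') = mvfderiv I F x.1 v :=
  (mfderiv_comp_apply x hF mdifferentiableAt_fst _).trans
    (congrArg (fun A : E × E' →L[ℝ] E ↦ mvfderiv I F x.1 (A (v, w))) mfderiv_fst)

variable [IsManifold I' 1 N]

theorem inner_christoffel {g : Π x : N, TangentSpace I' x →L[ℝ] TangentSpace I' x →L[ℝ] ℝ} {x : N}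
    (hg : (g x).IsInvertible) (v w z : TangentSpace I' x) :
    g x (christoffel g x v w) z = christoffelLower g x v w z :=
  congrArg (fun A : E' →L[ℝ] ℝ ↦ A z)
    (ContinuousLinearMap.IsInvertible.self_apply_inverse hg (christoffelLower g x v w))

theorem dMetricCoeff_symm {g : Π x : N, TangentSpace I' x →L[ℝ] TangentSpace I' x →L[ℝ] ℝ}
    (hsymm : ∀ x v w, g x v w = g x w v) {x : N}
    (hg : MDifferentiableAt I' 𝓘(ℝ, E' →L[ℝ] E' →L[ℝ] ℝ) (metricCoeff g x) x) (v w z : E') :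
    dMetricCoeff g x v w z = dMetricCoeff g x v z w := by
  have hcoeff : metricCoeff g x = fun y ↦ (metricCoeff g x y).flip := by
    ext y a b
    exact hsymm y _ _
  have h := mvfderiv_fderiv_comp
    (Φ := (ContinuousLinearMap.flipₗᵢ ℝ E' E' ℝ).toContinuousLinearEquiv)
    (ContinuousLinearEquiv.differentiableAt _) hg v
  rw [ContinuousLinearEquiv.fderiv] at h
  have h' := congrArg (fun F : N → E' →L[ℝ] E' →L[ℝ] ℝ ↦ mvfderiv I' F x v w z) hcoeff
  exact h'.trans (congrArg (fun B : E' →L[ℝ] E' →L[ℝ] ℝ ↦ B w z) h)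

theorem mdifferentiableAt_along_iff {f : M → N} {X : Π q : M, TangentSpace I' (f q)} {p : M} :
    MDifferentiableAt I I'.tangent (fun q ↦ (⟨f q, X q⟩ : TangentBundle I' N)) p ↔
      MDifferentiableAt I I' f p ∧
        MDifferentiableAt I 𝓘(ℝ, E') (fun q ↦ tangentCoord (f p) (X q)) p :=
  mdifferentiableAt_totalSpace I' _

theorem covDerivAlong_apply (g : Π x : N, TangentSpace I' x →L[ℝ] TangentSpace I' x →L[ℝ] ℝ)
    (f : M → N) (X : Π q : M, TangentSpace I' (f q)) (p : M) (v : TangentSpace I p) :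
    covDerivAlong g f X p v =
      mvfderiv I (fun q ↦ tangentCoord (f p) (X q)) p v +
      christoffel g (f p) (mfderiv I I' f p v) (X p) :=
  rfl

theorem covDerivAlong_smul (g : Π x : N, TangentSpace I' x →L[ℝ] TangentSpace I' x →L[ℝ] ℝ)
    {f : M → N} {X : Π q : M, TangentSpace I' (f q)} {c : M → ℝ} {p : M}
    (hc : MDifferentiableAt I 𝓘(ℝ, ℝ) c p)
    (hX : MDifferentiableAt I I'.tangent (fun q ↦ (⟨f q, X q⟩ : TangentBundle I' N)) p)
    (v : TangentSpace I p) :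
    covDerivAlong g f (fun q ↦ c q • X q) p v =
      mvfderiv I c p v • X p + c p • covDerivAlong g f X p v := by
  obtain ⟨hf, hX⟩ := mdifferentiableAt_along_iff.1 hX
  have hcoord : (fun q ↦ tangentCoord (f p) (c q • X q)) =ᶠ[nhds p]
      c • fun q ↦ tangentCoord (f p) (X q) := by
    filter_upwards [hf.continuousAt (chart_source_mem_nhds H' (f p))] with q hq
    exact ((trivializationAt E' (TangentSpace I' : N → Type _) (f p)).linear ℝ hq).map_smul _ _
  have hd : mvfderiv I (fun q ↦ tangentCoord (f p) (c q • X q)) p v =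
      mvfderiv I c p v • tangentCoord (f p) (X p) +
        c p • mvfderiv I (fun q ↦ tangentCoord (f p) (X q)) p v := by
    rw [mvfderiv_congr hcoord, mvfderiv_smul hc hX, add_comm]
    rfl
  have hΓ := (christoffel g (f p) (mfderiv I I' f p v)).map_smul (c p) (X p)
  rw [tangentCoord_self] at hd
  exact (congrArg₂ (fun a b : E' ↦ a + b) hd hΓ).trans
    ((add_assoc _ _ _).trans (congrArg _ (smul_add _ _ _).symm))

theorem mvfderiv_inner_along [FiniteDimensional ℝ E'] {n : ℕ∞ω}
    (g : Bundle.ContMDiffRiemannianMetric I' n E' (fun x : N ↦ TangentSpace I' x)) (hn : n ≠ 0)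
    {f : M → N} {X Y : Π q : M, TangentSpace I' (f q)} {p : M}
    (hX : MDifferentiableAt I I'.tangent (fun q ↦ (⟨f q, X q⟩ : TangentBundle I' N)) p)
    (hY : MDifferentiableAt I I'.tangent (fun q ↦ (⟨f q, Y q⟩ : TangentBundle I' N)) p)
    (v : TangentSpace I p) :
    mvfderiv I (fun q ↦ g.inner (f q) (X q) (Y q)) p v =
      g.inner (f p) (covDerivAlong g.inner f X p v) (Y p) +
        g.inner (f p) (X p) (covDerivAlong g.inner f Y p v) := by
  obtain ⟨hf, hX⟩ := mdifferentiableAt_along_iff.1 hX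
  obtain ⟨-, hY⟩ := mdifferentiableAt_along_iff.1 hY
  have hg := (contMDiffAt_metricCoeff g (f p)).mdifferentiableAt hn
  have hG : MDifferentiableAt I 𝓘(ℝ, E' →L[ℝ] E' →L[ℝ] ℝ)
      (fun q ↦ metricCoeff g.inner (f p) (f q)) p := hg.comp p hf
  have hcoord : (fun q ↦ g.inner (f q) (X q) (Y q)) =ᶠ[nhds p] fun q ↦
      metricCoeff g.inner (f p) (f q) (tangentCoord (f p) (X q)) (tangentCoord (f p) (Y q)) := by
    filter_upwards [hf.continuousAt (chart_source_mem_nhds H' (f p))] with q hq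
    exact (metricCoeff_tangentCoord g.inner hq _ _).symm
  have hdG : mvfderiv I (fun q ↦ metricCoeff g.inner (f p) (f q)) p v =
      dMetricCoeff g.inner (f p) (mfderiv I I' f p v) :=
    mfderiv_comp_apply p hg hf v
  have hΓ := koszulForm_add_koszulForm_swap (dMetricCoeff_symm g.symm hg) (mfderiv I I' f p v)
    (X p) (Y p)
  rw [← christoffelLower, ← inner_christoffel (isInvertible_inner g _),
    ← inner_christoffel (isInvertible_inner g _)] at hΓ
  have hsum {G D : E' →L[ℝ] E' →L[ℝ] ℝ} {x y x' y' a b : E'} (hG : G x b = G b x)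
      (hD : G a y + G b x = D x y) :
      (D x + G x') y + G x y' = G (x' + a) y + G x (y' + b) := by
    simp only [map_add, _root_.add_apply, ← hD, hG]
    ring
  rw [mvfderiv_congr hcoord, mvfderiv_clm_apply (hG.clm_apply hX) hY, mvfderiv_clm_apply hG hX,
    hdG, covDerivAlong_apply, covDerivAlong_apply, tangentCoord_self, tangentCoord_self,
    metricCoeff_self]
  exact hsum (g.symm (f p) _ _) hΓ

theorem secondFundamentalForm_apply
    (g : Π x : N, TangentSpace I' x →L[ℝ] TangentSpace I' x →L[ℝ] ℝ) (f : M → N)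
    (ν : Π q : M, TangentSpace I' (f q)) (p : M) (v w : TangentSpace I p) :
    secondFundamentalForm g f ν p v w = -g (f p) (covDerivAlong g f ν p v) (mfderiv I I' f p w) :=
  rfl

theorem secondFundamentalForm_smul
    {g : Π x : N, TangentSpace I' x →L[ℝ] TangentSpace I' x →L[ℝ] ℝ} {f : M → N}
    {ν : Π q : M, TangentSpace I' (f q)} {c : M → ℝ} {p : M}
    (hc : MDifferentiableAt I 𝓘(ℝ, ℝ) c p)
    (hν : MDifferentiableAt I I'.tangent (fun q ↦ (⟨f q, ν q⟩ : TangentBundle I' N)) p)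
    (hnormal : ∀ w : TangentSpace I p, g (f p) (ν p) (mfderiv I I' f p w) = 0) :
    secondFundamentalForm (I := I) g f (fun q ↦ c q • ν q) p =
      c p • secondFundamentalForm (I := I) g f ν p := by
  ext v w
  simp only [_root_.smul_apply, secondFundamentalForm_apply, covDerivAlong_smul g hc hν, map_add,
    map_smul, _root_.add_apply, hnormal, smul_zero, zero_add, smul_neg]

theorem meanCurvature_smul [IsManifold I 1 M]
    {g : Π x : N, TangentSpace I' x →L[ℝ] TangentSpace I' x →L[ℝ] ℝ} {f : M → N}
    {ν : Π q : M, TangentSpace I' (f q)} {c : M → ℝ} {p : M}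
    (hc : MDifferentiableAt I 𝓘(ℝ, ℝ) c p)
    (hν : MDifferentiableAt I I'.tangent (fun q ↦ (⟨f q, ν q⟩ : TangentBundle I' N)) p)
    (hnormal : ∀ w : TangentSpace I p, g (f p) (ν p) (mfderiv I I' f p w) = 0) :
    meanCurvature I g f (fun q ↦ c q • ν q) p = c p * meanCurvature I g f ν p := by
  rw [meanCurvature, secondFundamentalForm_smul hc hν hnormal]
  exact metricTrace_smul _ _ _

end CovariantDerivative

section Gradient

variable {E : Type*} [NormedAddCommGroup E] [NormedSpace ℝ E] [FiniteDimensional ℝ E]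
  {H : Type*} [TopologicalSpace H] {I : ModelWithCorners ℝ E H}
  {M : Type*} [TopologicalSpace M] [ChartedSpace H M] [IsManifold I 1 M] {n : ℕ∞ω}
  (g : Bundle.ContMDiffRiemannianMetric I n E (fun x : M ↦ TangentSpace I x))

theorem inner_grad (u : M → ℝ) (p : M) (v : TangentSpace I p) :
    g.inner p (grad g.inner u p) v = mvfderiv I u p v :=
  congrArg (fun A : E →L[ℝ] ℝ ↦ A v) ((isInvertible_inner g p).self_apply_inverse (mvfderiv I u p))

theorem tangentCoord_grad (u : M → ℝ) {p q : M} (hq : q ∈ (chartAt H p).source) :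
    tangentCoord p (grad g.inner u q) = (metricCoeff g.inner p q).inverse
      ((mvfderiv I u q : E →L[ℝ] ℝ) ∘L
        ((trivializationAt E (TangentSpace I : M → Type _) p).symmL ℝ q : E →L[ℝ] E)) := by
  have h : metricCoeff g.inner p q (tangentCoord p (grad g.inner u q)) =
      (mvfderiv I u q : E →L[ℝ] ℝ) ∘L
        ((trivializationAt E (TangentSpace I : M → Type _) p).symmL ℝ q : E →L[ℝ] E) := by
    ext v
    rw [metricCoeff_apply, symmL_tangentCoord hq]
    exact inner_grad g u q _
  rw [← h, (isInvertible_metricCoeff g hq).inverse_apply_self]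

theorem contMDiffAt_grad {u : M → ℝ} {p : M}
    (hu : ContMDiffAt I 𝓘(ℝ, ℝ) (n + 1) u p) :
    ContMDiffAt I I.tangent n (fun q ↦ (⟨q, grad g.inner u q⟩ : TangentBundle I M)) p := by
  have hinv : ContMDiffAt I 𝓘(ℝ, (E →L[ℝ] ℝ) →L[ℝ] E) n
      (fun q ↦ (metricCoeff g.inner p q).inverse) p :=
    ContMDiffAt.comp p (I' := 𝓘(ℝ, E →L[ℝ] E →L[ℝ] ℝ))
      (isInvertible_metricCoeff g (mem_chart_source H p)).contDiffAt_map_inverse.contMDiffAt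
      (contMDiffAt_metricCoeff g p)
  have hdu : ContMDiffAt I 𝓘(ℝ, E →L[ℝ] ℝ) n (fun q ↦ (mvfderiv I u q : E →L[ℝ] ℝ) ∘L
      ((trivializationAt E (TangentSpace I : M → Type _) p).symmL ℝ q : E →L[ℝ] E)) p := by
    refine (hu.mfderiv_const le_rfl).congr_of_eventuallyEq (.of_forall fun q ↦ ?_)
    ext v
    exact (congrArg (fun A : ℝ →L[ℝ] ℝ ↦ A (mvfderiv I u q _))
      (TangentBundle.continuousLinearMapAt_model_space (𝕜 := ℝ) (u p) (u q))).symm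
  refine (Bundle.contMDiffAt_section _).2 ((hinv.clm_apply hdu).congr_of_eventuallyEq ?_)
  filter_upwards [chart_source_mem_nhds H p] with q hq
  exact tangentCoord_grad g u hq

/-- The Hessian `v ↦ ∇_v grad u` of `u` as an endomorphism of the tangent space. -/
noncomputable def hessianEndo (g : Π x : M, TangentSpace I x →L[ℝ] TangentSpace I x →L[ℝ] ℝ)
    (u : M → ℝ) (p : M) : TangentSpace I p →L[ℝ] TangentSpace I p :=
  covDerivAlong g (fun q ↦ q) (grad g u) p

theorem mvfderiv_gradSq {M : Type*} [TopologicalSpace M] [ChartedSpace E M] [IsManifold 𝓘(ℝ, E) 1 M]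
    (g : Bundle.ContMDiffRiemannianMetric 𝓘(ℝ, E) n E (fun x : M ↦ TangentSpace 𝓘(ℝ, E) x))
    (hn : n ≠ 0) {u : M → ℝ} {p : M} (hu : ContMDiffAt 𝓘(ℝ, E) 𝓘(ℝ, ℝ) (n + 1) u p)
    (v : TangentSpace 𝓘(ℝ, E) p) :
    mvfderiv 𝓘(ℝ, E) (gradSq g.inner u) p v =
      2 * g.inner p (hessianEndo g.inner u p v) (grad g.inner u p) := by
  have hX := (contMDiffAt_grad g hu).mdifferentiableAt hn
  refine (mvfderiv_inner_along g hn hX hX v).trans ?_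
  rw [g.symm p (grad g.inner u p), two_mul, hessianEndo]

end Gradient

section OpenSubset

variable {V : Type*} [NormedAddCommGroup V] [NormedSpace ℝ V] {U : TopologicalSpace.Opens V}

theorem tangentCoord_opens (x : U) {y : U} (v : TangentSpace 𝓘(ℝ, V) y) : tangentCoord x v = v :=
  tangentCoord_self (I := 𝓘(ℝ, V)) y v

theorem symmL_opens (x y : U) (v : V) :
    (trivializationAt V (TangentSpace 𝓘(ℝ, V) : U → Type _) x).symmL ℝ y v = v :=
  (tangentCoord_opens x _).symm.trans (tangentCoord_symmL (mem_chart_source V y) v)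

theorem hasMFDerivAt_opens_coe (z : U) :
    HasMFDerivAt 𝓘(ℝ, V) 𝓘(ℝ, V) (Subtype.val : U → V) z (ContinuousLinearMap.id ℝ V) := by
  refine ⟨continuous_subtype_val.continuousAt, ?_⟩
  refine (hasFDerivWithinAt_id _ _).congr_of_eventuallyEq ?_ ?_
  · filter_upwards [extChartAt_target_mem_nhdsWithin (I := 𝓘(ℝ, V)) z] with s hs
    exact (extChartAt 𝓘(ℝ, V) z).right_inv hs
  · simp only [writtenInExtChartAt, Function.comp_apply, extChartAt_to_inv]
    rfl

theorem mvfderiv_opens_coe {E : Type*} [NormedAddCommGroup E] [NormedSpace ℝ E]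
    {H : Type*} [TopologicalSpace H] {I : ModelWithCorners ℝ E H}
    {M : Type*} [TopologicalSpace M] [ChartedSpace H M] {u : M → U} {p : M}
    (hu : MDifferentiableAt I 𝓘(ℝ, V) u p) :
    mvfderiv I (fun q ↦ (u q : V)) p = mfderiv I 𝓘(ℝ, V) u p :=
  (HasMFDerivAt.comp (I' := 𝓘(ℝ, V)) (I'' := 𝓘(ℝ, V)) p (hasMFDerivAt_opens_coe (u p))
    hu.hasMFDerivAt).mfderiv

end OpenSubset

section ProductCoordinates

variable {E : Type*} [NormedAddCommGroup E] [NormedSpace ℝ E]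
  {H : Type*} [TopologicalSpace H] {I : ModelWithCorners ℝ E H}
  {M : Type*} [TopologicalSpace M] [ChartedSpace H M] [IsManifold I 1 M]
  {E' : Type*} [NormedAddCommGroup E'] [NormedSpace ℝ E']
  {H' : Type*} [TopologicalSpace H'] {I' : ModelWithCorners ℝ E' H'}
  {N : Type*} [TopologicalSpace N] [ChartedSpace H' N] [IsManifold I' 1 N]

theorem hasFDerivWithinAt_coordChange_tangentCoord {x q : M} (hq : q ∈ (chartAt H x).source) :
    HasFDerivWithinAt (extChartAt I x ∘ (extChartAt I q).symm) (tangentCoordChange I q x q)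
      (Set.range I) (extChartAt I q q) :=
  hasFDerivWithinAt_tangentCoordChange
    ⟨mem_extChartAt_source q, by rwa [extChartAt_source]⟩

theorem tangentCoord_prod {x y : M × N} (hy : y ∈ (chartAt (ModelProd H H') x).source)
    (v : E) (w : E') :
    tangentCoord (I := I.prod I') x (q := y) ((v, w) : E × E') =
      (tangentCoord (I := I) x.1 (q := y.1) v, tangentCoord (I := I') x.2 (q := y.2) w) := by
  obtain ⟨h₁, h₂⟩ : y.1 ∈ (chartAt H x.1).source ∧ y.2 ∈ (chartAt H' x.2).source := by
    rwa [prodChartedSpace_chartAt] at hy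
  have h := HasFDerivWithinAt.prodMap (s := Set.range I ×ˢ Set.range I')
    (p := (extChartAt I y.1 y.1, extChartAt I' y.2 y.2))
    ((hasFDerivWithinAt_coordChange_tangentCoord (I := I) h₁).mono (Set.fst_image_prod_subset _ _))
    ((hasFDerivWithinAt_coordChange_tangentCoord (I := I') h₂).mono (Set.snd_image_prod_subset _ _))
  rw [← ModelWithCorners.range_prod] at h
  have h' := hasFDerivWithinAt_coordChange_tangentCoord (I := I.prod I') hy
  have huniq := (I.prod I').uniqueDiffOn (extChartAt (I.prod I') y y) (Set.mem_range_self _)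
  rw [extChartAt_prod, extChartAt_prod] at h'
  rw [extChartAt_prod] at huniq
  exact congrArg (fun A : E × E' →L[ℝ] E × E' ↦ A (v, w)) (huniq.eq h' h)

theorem symmL_prod {x y : M × N} (hy : y ∈ (chartAt (ModelProd H H') x).source) (v : E) (w : E') :
    (trivializationAt (E × E') (TangentSpace (I.prod I') : M × N → Type _) x).symmL ℝ y (v, w) =
      (((trivializationAt E (TangentSpace I : M → Type _) x.1).symmL ℝ y.1 v,
        (trivializationAt E' (TangentSpace I' : N → Type _) x.2).symmL ℝ y.2 w) : E × E') := by
  obtain ⟨h₁, h₂⟩ : y.1 ∈ (chartAt H x.1).source ∧ y.2 ∈ (chartAt H' x.2).source := by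
    rwa [prodChartedSpace_chartAt] at hy
  have h := tangentCoord_prod (I := I) (I' := I') hy
    ((trivializationAt E (TangentSpace I : M → Type _) x.1).symmL ℝ y.1 v)
    ((trivializationAt E' (TangentSpace I' : N → Type _) x.2).symmL ℝ y.2 w)
  rw [tangentCoord_symmL h₁, tangentCoord_symmL h₂] at h
  exact (congrArg _ h.symm).trans (symmL_tangentCoord hy _)

end ProductCoordinates

section WarpedProduct

variable {E : Type*} [NormedAddCommGroup E] [NormedSpace ℝ E]
  {M : Type*} [TopologicalSpace M] [ChartedSpace E M] {J : TopologicalSpace.Opens ℝ}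

theorem dz_apply (x : M × J) (v : E) (t : ℝ) : dz (E := E) x ((v, t) : E × ℝ) = t := by
  have h : dz (E := E) x = _ := (mvfderiv_opens_coe mdifferentiableAt_snd).trans mfderiv_snd
  exact congrArg (fun A : E × ℝ →L[ℝ] ℝ ↦ A (v, t)) h

theorem mdifferentiableAt_comp_coord {Φ : ℝ → ℝ} {x : M × J} (hΦ : DifferentiableAt ℝ Φ x.2) :
    MDifferentiableAt (𝓘(ℝ, E).prod 𝓘(ℝ, ℝ)) 𝓘(ℝ, ℝ) (fun y : M × J ↦ Φ y.2) x :=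
  DifferentiableAt.comp_mdifferentiableAt (f := fun y : M × J ↦ (y.2 : ℝ)) hΦ
    ((hasMFDerivAt_opens_coe x.2).mdifferentiableAt.comp x mdifferentiableAt_snd)

theorem mvfderiv_comp_coord {Φ : ℝ → ℝ} {x : M × J} (hΦ : DifferentiableAt ℝ Φ x.2) (v : E)
    (s : ℝ) :
    mvfderiv (𝓘(ℝ, E).prod 𝓘(ℝ, ℝ)) (fun y : M × J ↦ Φ y.2) x ((v, s) : E × ℝ) =
      deriv Φ x.2 * s := by
  have hz : MDifferentiableAt (𝓘(ℝ, E).prod 𝓘(ℝ, ℝ)) 𝓘(ℝ, ℝ) (fun y : M × J ↦ (y.2 : ℝ)) x :=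
    mdifferentiableAt_comp_coord (Φ := id) differentiableAt_id
  refine (mvfderiv_fderiv_comp (F := fun y : M × J ↦ (y.2 : ℝ)) hΦ hz _).trans
    ((congrArg (fderiv ℝ Φ x.2) (dz_apply x v s)).trans ?_)
  rw [fderiv_eq_smul_deriv, smul_eq_mul, mul_comm]

theorem mdifferentiableAt_coord_smul_fst {W : Type*} [NormedAddCommGroup W] [NormedSpace ℝ W]
    {Φ : ℝ → ℝ} {F : M → W} {x : M × J} (hΦ : DifferentiableAt ℝ Φ x.2)
    (hF : MDifferentiableAt 𝓘(ℝ, E) 𝓘(ℝ, W) F x.1) :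
    MDifferentiableAt (𝓘(ℝ, E).prod 𝓘(ℝ, ℝ)) 𝓘(ℝ, W) (fun y : M × J ↦ Φ y.2 • F y.1) x :=
  (mdifferentiableAt_comp_coord hΦ).smul (hF.comp x mdifferentiableAt_fst)

theorem mvfderiv_coord_smul_fst {W : Type*} [NormedAddCommGroup W] [NormedSpace ℝ W]
    {Φ : ℝ → ℝ} {F : M → W} {x : M × J} (hΦ : DifferentiableAt ℝ Φ x.2)
    (hF : MDifferentiableAt 𝓘(ℝ, E) 𝓘(ℝ, W) F x.1) (v : E) (s : ℝ) :
    mvfderiv (𝓘(ℝ, E).prod 𝓘(ℝ, ℝ)) (fun y : M × J ↦ Φ y.2 • F y.1) x ((v, s) : E × ℝ) =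
      Φ x.2 • mvfderiv 𝓘(ℝ, E) F x.1 v + (deriv Φ x.2 * s) • F x.1 := by
  have h := mvfderiv_fun_smul (mdifferentiableAt_comp_coord hΦ)
    (MDifferentiableAt.comp (I' := 𝓘(ℝ, E)) x hF mdifferentiableAt_fst)
  exact (congrArg (fun A : E × ℝ →L[ℝ] W ↦ A (v, s)) h).trans
    (congrArg₂ (fun (a : W) (c : ℝ) ↦ Φ x.2 • a + c • F x.1) (mvfderiv_comp_fst hF v s)
      (mvfderiv_comp_coord hΦ v s))

theorem warpedMetric_apply
    (g : Π x : M, TangentSpace 𝓘(ℝ, E) x →L[ℝ] TangentSpace 𝓘(ℝ, E) x →L[ℝ] ℝ) (r : ℝ → ℝ)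
    (x : M × J) (v w : E) (s t : ℝ) :
    warpedMetric g r x ((v, s) : E × ℝ) ((w, t) : E × ℝ) = r x.2 ^ 2 * g x.1 v w + s * t := by
  have hfst (v : E) (s : ℝ) : (mfderiv (𝓘(ℝ, E).prod 𝓘(ℝ, ℝ)) 𝓘(ℝ, E)
      (Prod.fst : M × J → M) x : E × ℝ →L[ℝ] E) (v, s) = v :=
    congrArg (fun A : E × ℝ →L[ℝ] E ↦ A (v, s)) mfderiv_fst
  have hpull := congrArg₂ (fun a b : E ↦ r x.2 ^ 2 * g x.1 a b) (hfst v s) (hfst w t)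
  exact congrArg₂ (· + ·) hpull (congrArg₂ (· * ·) (dz_apply x v s) (dz_apply x w t))

theorem isInvertible_warpedMetric [FiniteDimensional ℝ E]
    {g : Π x : M, TangentSpace 𝓘(ℝ, E) x →L[ℝ] TangentSpace 𝓘(ℝ, E) x →L[ℝ] ℝ} {r : ℝ → ℝ}
    {x : M × J} (hg : ∀ v, v ≠ 0 → 0 < g x.1 v v) (hr : r x.2 ≠ 0) :
    (warpedMetric g r x).IsInvertible := by
  refine isInvertible_of_pos (E := E × ℝ) fun (v, t) hvt ↦ ?_
  refine (warpedMetric_apply g r x v v t t).symm ▸ ?_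
  obtain rfl | hv := eq_or_ne v 0
  · have ht : t ≠ 0 := fun ht ↦ hvt (Prod.ext rfl ht)
    have h0 : g x.1 (0 : E) (0 : E) = 0 := map_zero _
    rw [h0, mul_zero, zero_add]
    exact mul_self_pos.2 ht
  · exact add_pos_of_pos_of_nonneg (mul_pos (sq_pos_of_ne_zero hr) (hg v hv)) (mul_self_nonneg t)

end WarpedProduct

section WarpedConnection

/-- Pullback of bilinear forms `G ↦ pullForm G A A`, as a continuous linear map, so that it can be
differentiated. -/
noncomputable def pullFormL {E E' : Type*} [NormedAddCommGroup E] [NormedSpace ℝ E]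
    [NormedAddCommGroup E'] [NormedSpace ℝ E'] (A : E →L[ℝ] E') :
    (E' →L[ℝ] E' →L[ℝ] ℝ) →L[ℝ] (E →L[ℝ] E →L[ℝ] ℝ) :=
  (ContinuousLinearMap.compL ℝ E E' (E →L[ℝ] ℝ)).flip A ∘L
    ContinuousLinearMap.compL ℝ E' (E' →L[ℝ] ℝ) (E →L[ℝ] ℝ)
      ((ContinuousLinearMap.compL ℝ E E' ℝ).flip A)

variable {E : Type*} [NormedAddCommGroup E] [NormedSpace ℝ E]
  {M : Type*} [TopologicalSpace M] [ChartedSpace E M] [IsManifold 𝓘(ℝ, E) 1 M]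
  {J : TopologicalSpace.Opens ℝ} {r : ℝ → ℝ}

theorem metricCoeff_warpedMetric
    (g : Π x : M, TangentSpace 𝓘(ℝ, E) x →L[ℝ] TangentSpace 𝓘(ℝ, E) x →L[ℝ] ℝ) (r : ℝ → ℝ)
    {x y : M × J} (hy : y ∈ (chartAt (ModelProd E ℝ) x).source) :
    metricCoeff (warpedMetric g r) x y =
      r y.2 ^ 2 • pullFormL (.fst ℝ E ℝ) (metricCoeff g x.1 y.1) +
        (ContinuousLinearMap.snd ℝ E ℝ).smulRight (.snd ℝ E ℝ) := by
  refine ContinuousLinearMap.ext fun (v, s) ↦ ContinuousLinearMap.ext fun (w, t) ↦ ?_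
  rw [metricCoeff_apply, symmL_prod hy, symmL_prod hy, symmL_opens, symmL_opens]
  exact warpedMetric_apply g r y _ _ s t

variable {g : Π x : M, TangentSpace 𝓘(ℝ, E) x →L[ℝ] TangentSpace 𝓘(ℝ, E) x →L[ℝ] ℝ} {x : M × J}

theorem dMetricCoeff_warpedMetric
    (hg : MDifferentiableAt 𝓘(ℝ, E) 𝓘(ℝ, E →L[ℝ] E →L[ℝ] ℝ) (metricCoeff g x.1) x.1)
    (hr : DifferentiableAt ℝ r x.2) (v w y : E) (s t a : ℝ) :
    dMetricCoeff (warpedMetric g r) x ((v, s) : E × ℝ) (w, t) (y, a) =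
      r x.2 ^ 2 * dMetricCoeff g x.1 v w y + 2 * r x.2 * deriv r x.2 * s * g x.1 w y := by
  let P : (E →L[ℝ] E →L[ℝ] ℝ) →L[ℝ] E × ℝ →L[ℝ] E × ℝ →L[ℝ] ℝ := pullFormL (.fst ℝ E ℝ)
  have hcoeff : metricCoeff (warpedMetric g r) x =ᶠ[nhds x] fun y ↦
      r y.2 ^ 2 • P (metricCoeff g x.1 y.1) +
        (ContinuousLinearMap.snd ℝ E ℝ).smulRight (.snd ℝ E ℝ) := by
    filter_upwards [chart_source_mem_nhds (ModelProd E ℝ) x] with y hy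
    exact metricCoeff_warpedMetric g r hy
  have hr₂ : HasDerivAt (fun z ↦ r z ^ 2) (2 * r x.2 * deriv r x.2) x.2 := by
    simpa using hr.hasDerivAt.fun_pow 2
  have hP : MDifferentiableAt 𝓘(ℝ, E) 𝓘(ℝ, E × ℝ →L[ℝ] E × ℝ →L[ℝ] ℝ)
      (fun q ↦ P (metricCoeff g x.1 q)) x.1 :=
    P.differentiableAt.comp_mdifferentiableAt hg
  have hdP : mvfderiv 𝓘(ℝ, E) (fun q ↦ P (metricCoeff g x.1 q)) x.1 v =
      P (dMetricCoeff g x.1 v) := by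
    refine (mvfderiv_fderiv_comp P.differentiableAt hg v).trans ?_
    rw [P.fderiv]
    rfl
  have hd : dMetricCoeff (warpedMetric g r) x = mvfderiv (𝓘(ℝ, E).prod 𝓘(ℝ, ℝ))
      (fun y : M × J ↦ r y.2 ^ 2 • P (metricCoeff g x.1 y.1)) x := by
    refine (mvfderiv_congr hcoeff).trans ((mvfderiv_fun_add
      (mdifferentiableAt_coord_smul_fst hr₂.differentiableAt hP) mdifferentiableAt_const).trans ?_)
    rw [mvfderiv_const, add_zero]
  have h : dMetricCoeff (warpedMetric g r) x ((v, s) : E × ℝ) =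
      r x.2 ^ 2 • P (dMetricCoeff g x.1 v) + (2 * r x.2 * deriv r x.2 * s) • P (g x.1) := by
    rw [hd, ← hdP, ← hr₂.deriv, ← metricCoeff_self g x.1]
    exact mvfderiv_coord_smul_fst hr₂.differentiableAt hP v s
  rw [h]
  rfl

theorem christoffelLower_warpedMetric
    (hg : MDifferentiableAt 𝓘(ℝ, E) 𝓘(ℝ, E →L[ℝ] E →L[ℝ] ℝ) (metricCoeff g x.1) x.1)
    (hr : DifferentiableAt ℝ r x.2) (v w y : E) (s t a : ℝ) :
    christoffelLower (warpedMetric g r) x ((v, s) : E × ℝ) (w, t) (y, a) =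
      r x.2 ^ 2 * christoffelLower g x.1 v w y +
        r x.2 * deriv r x.2 * (s * g x.1 w y + t * g x.1 v y - a * g x.1 v w) := by
  rw [christoffelLower, christoffelLower, koszulForm_apply, koszulForm_apply,
    dMetricCoeff_warpedMetric hg hr, dMetricCoeff_warpedMetric hg hr,
    dMetricCoeff_warpedMetric hg hr]
  ring

theorem inner_christoffel_warpedMetric [FiniteDimensional ℝ E] (hpos : ∀ v, v ≠ 0 → 0 < g x.1 v v)
    (hg : MDifferentiableAt 𝓘(ℝ, E) 𝓘(ℝ, E →L[ℝ] E →L[ℝ] ℝ) (metricCoeff g x.1) x.1)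
    (hr₀ : r x.2 ≠ 0) (hr : DifferentiableAt ℝ r x.2) (v w y : E) (s t a : ℝ) :
    warpedMetric g r x (christoffel (warpedMetric g r) x ((v, s) : E × ℝ) ((w, t) : E × ℝ))
      ((y, a) : E × ℝ) =
      r x.2 ^ 2 * g x.1 (christoffel g x.1 v w) y +
        r x.2 * deriv r x.2 * (s * g x.1 w y + t * g x.1 v y - a * g x.1 v w) := by
  rw [inner_christoffel (isInvertible_of_pos (E := E) hpos) v w y]
  exact (inner_christoffel (isInvertible_warpedMetric hpos hr₀) _ _ _).trans
    (christoffelLower_warpedMetric hg hr v w y s t a)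

end WarpedConnection

section WarpedAlong

variable {E₀ : Type*} [NormedAddCommGroup E₀] [NormedSpace ℝ E₀]
  {H₀ : Type*} [TopologicalSpace H₀] {I : ModelWithCorners ℝ E₀ H₀}
  {B : Type*} [TopologicalSpace B] [ChartedSpace H₀ B]
  {E : Type*} [NormedAddCommGroup E] [NormedSpace ℝ E]
  {M : Type*} [TopologicalSpace M] [ChartedSpace E M] [IsManifold 𝓘(ℝ, E) 1 M]
  {J : TopologicalSpace.Opens ℝ} {f₁ : B → M} {f₂ : B → J}
  {X : Π q : B, TangentSpace 𝓘(ℝ, E) (f₁ q)} {φ : B → ℝ} {p : B}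

theorem tangentCoord_prodMk_eventuallyEq (hf₁ : ContinuousAt f₁ p) (hf₂ : ContinuousAt f₂ p)
    (X : Π q : B, TangentSpace 𝓘(ℝ, E) (f₁ q)) (φ : B → ℝ) :
    (fun q ↦ tangentCoord (I := 𝓘(ℝ, E).prod 𝓘(ℝ, ℝ)) (f₁ p, f₂ p)
      (q := (f₁ q, f₂ q)) ((X q, φ q) : E × ℝ)) =ᶠ[nhds p]
      fun q ↦ (tangentCoord (f₁ p) (X q), φ q) := by
  filter_upwards [(hf₁.prodMk hf₂) (chart_source_mem_nhds (ModelProd E ℝ) (f₁ p, f₂ p))] with q hq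
  exact (tangentCoord_prod hq _ _).trans (congrArg _ (tangentCoord_opens _ _))

theorem contMDiffAt_along_prodMk {n : ℕ∞ω}
    (hX : ContMDiffAt I 𝓘(ℝ, E).tangent n
      (fun q ↦ (⟨f₁ q, X q⟩ : TangentBundle 𝓘(ℝ, E) M)) p)
    (hf₂ : ContMDiffAt I 𝓘(ℝ, ℝ) n f₂ p) (hφ : ContMDiffAt I 𝓘(ℝ, ℝ) n φ p) :
    ContMDiffAt I (𝓘(ℝ, E).prod 𝓘(ℝ, ℝ)).tangent n
      (fun q ↦ (⟨(f₁ q, f₂ q), ((X q, φ q) : E × ℝ)⟩ :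
        TangentBundle (𝓘(ℝ, E).prod 𝓘(ℝ, ℝ)) (M × J))) p := by
  obtain ⟨hf₁, hX⟩ := Bundle.contMDiffAt_totalSpace.1 hX
  exact Bundle.contMDiffAt_totalSpace.2 ⟨hf₁.prodMk hf₂, (hX.prodMk_space hφ).congr_of_eventuallyEq
    (tangentCoord_prodMk_eventuallyEq hf₁.continuousAt hf₂.continuousAt X φ)⟩

theorem mvfderiv_tangentCoord_prod
    (hf₁ : ContinuousAt f₁ p) (hf₂ : ContinuousAt f₂ p)
    (hX : MDifferentiableAt I 𝓘(ℝ, E) (fun q ↦ tangentCoord (f₁ p) (X q)) p)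
    (hφ : MDifferentiableAt I 𝓘(ℝ, ℝ) φ p) (v : TangentSpace I p) :
    mvfderiv I (fun q ↦ tangentCoord (I := 𝓘(ℝ, E).prod 𝓘(ℝ, ℝ)) (f₁ p, f₂ p)
      (q := (f₁ q, f₂ q)) ((X q, φ q) : E × ℝ)) p v =
      (mvfderiv I (fun q ↦ tangentCoord (f₁ p) (X q)) p v, mvfderiv I φ p v) := by
  rw [← mvfderiv_prodMk hX hφ]
  exact congrArg (fun A : E₀ →L[ℝ] E × ℝ ↦ A v)
    (mvfderiv_congr (tangentCoord_prodMk_eventuallyEq hf₁ hf₂ X φ))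

theorem covDerivAlong_prodMk
    (G : Π x : M × J, TangentSpace (𝓘(ℝ, E).prod 𝓘(ℝ, ℝ)) x →L[ℝ]
      TangentSpace (𝓘(ℝ, E).prod 𝓘(ℝ, ℝ)) x →L[ℝ] ℝ)
    (hX : MDifferentiableAt I 𝓘(ℝ, E).tangent
      (fun q ↦ (⟨f₁ q, X q⟩ : TangentBundle 𝓘(ℝ, E) M)) p)
    (hf₂ : MDifferentiableAt I 𝓘(ℝ, ℝ) f₂ p) (hφ : MDifferentiableAt I 𝓘(ℝ, ℝ) φ p)
    (v : TangentSpace I p) :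
    covDerivAlong G (fun q ↦ (f₁ q, f₂ q)) (fun q ↦ ((X q, φ q) : E × ℝ)) p v =
      ((mvfderiv I (fun q ↦ tangentCoord (f₁ p) (X q)) p v, mvfderiv I φ p v) : E × ℝ) +
        christoffel G (f₁ p, f₂ p)
          ((mfderiv I 𝓘(ℝ, E) f₁ p v, mvfderiv I (fun q ↦ (f₂ q : ℝ)) p v) : E × ℝ)
          ((X p, φ p) : E × ℝ) := by
  obtain ⟨hf₁, hX⟩ := mdifferentiableAt_along_iff.1 hX
  have hd := mvfderiv_tangentCoord_prod hf₁.continuousAt hf₂.continuousAt hX hφ v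
  have hdf : mfderiv I (𝓘(ℝ, E).prod 𝓘(ℝ, ℝ)) (fun q ↦ (f₁ q, f₂ q)) p v =
      ((mfderiv I 𝓘(ℝ, E) f₁ p v, mvfderiv I (fun q ↦ (f₂ q : ℝ)) p v) : E × ℝ) := by
    rw [hf₁.mfderiv_prod hf₂, mvfderiv_opens_coe hf₂]
    rfl
  exact congrArg₂ (fun a b : E × ℝ ↦ a + christoffel G (f₁ p, f₂ p) b (X p, φ p)) hd hdf

/- O'Neill's formulas for the Levi-Civita connection of a warped product, collected in a single
identity. -/
theorem warpedMetric_covDerivAlong [FiniteDimensional ℝ E]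
    {g : Π x : M, TangentSpace 𝓘(ℝ, E) x →L[ℝ] TangentSpace 𝓘(ℝ, E) x →L[ℝ] ℝ} {r : ℝ → ℝ}
    (hpos : ∀ v, v ≠ 0 → 0 < g (f₁ p) v v)
    (hg : MDifferentiableAt 𝓘(ℝ, E) 𝓘(ℝ, E →L[ℝ] E →L[ℝ] ℝ) (metricCoeff g (f₁ p)) (f₁ p))
    (hr₀ : r (f₂ p) ≠ 0) (hr : DifferentiableAt ℝ r (f₂ p))
    (hX : MDifferentiableAt I 𝓘(ℝ, E).tangent
      (fun q ↦ (⟨f₁ q, X q⟩ : TangentBundle 𝓘(ℝ, E) M)) p)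
    (hf₂ : MDifferentiableAt I 𝓘(ℝ, ℝ) f₂ p) (hφ : MDifferentiableAt I 𝓘(ℝ, ℝ) φ p)
    (v : TangentSpace I p) (y : E) (s : ℝ) :
    warpedMetric g r (f₁ p, f₂ p)
      (covDerivAlong (warpedMetric g r) (fun q ↦ (f₁ q, f₂ q)) (fun q ↦ ((X q, φ q) : E × ℝ)) p v)
      ((y, s) : E × ℝ) =
    r (f₂ p) ^ 2 * g (f₁ p) (covDerivAlong g f₁ X p v) y + mvfderiv I φ p v * s +
      r (f₂ p) * deriv r (f₂ p) * (mvfderiv I (fun q ↦ (f₂ q : ℝ)) p v * g (f₁ p) (X p) y +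
        φ p * g (f₁ p) (mfderiv I 𝓘(ℝ, E) f₁ p v) y -
        s * g (f₁ p) (mfderiv I 𝓘(ℝ, E) f₁ p v) (X p)) := by
  let dX : E := mvfderiv I (fun q ↦ tangentCoord (f₁ p) (X q)) p v
  let G : E × ℝ →L[ℝ] E × ℝ →L[ℝ] ℝ := warpedMetric g r (f₁ p, f₂ p)
  have hcoord : G (dX, mvfderiv I φ p v) (y, s) =
      r (f₂ p) ^ 2 * g (f₁ p) dX y + mvfderiv I φ p v * s := warpedMetric_apply g r _ _ _ _ _
  have hΓ := inner_christoffel_warpedMetric (x := (f₁ p, f₂ p)) hpos hg hr₀ hr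
    (mfderiv I 𝓘(ℝ, E) f₁ p v) (X p) y (mvfderiv I (fun q ↦ (f₂ q : ℝ)) p v) (φ p) s
  have hM : g (f₁ p) (covDerivAlong g f₁ X p v) y =
      g (f₁ p) dX y + g (f₁ p) (christoffel g (f₁ p) (mfderiv I 𝓘(ℝ, E) f₁ p v) (X p)) y :=
    (g (f₁ p) : E →L[ℝ] E →L[ℝ] ℝ).map_add₂ _ _ _
  rw [covDerivAlong_prodMk _ hX hf₂ hφ, hM]
  refine (G.map_add₂ _ _ _).trans ((congrArg₂ (· + ·) hcoord hΓ).trans ?_)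
  ring

end WarpedAlong

section Graph

variable {E : Type*} [NormedAddCommGroup E] [NormedSpace ℝ E]
  {M : Type*} [TopologicalSpace M] [ChartedSpace E M]
  {J : TopologicalSpace.Opens ℝ} {r : ℝ → ℝ} {u : M → J} {p : M} {n : ℕ∞ω}

theorem contMDiffAt_coe (hu : ContMDiffAt 𝓘(ℝ, E) 𝓘(ℝ, ℝ) n u p) :
    ContMDiffAt 𝓘(ℝ, E) 𝓘(ℝ, ℝ) n (fun q ↦ (u q : ℝ)) p :=
  contMDiff_subtype_val.contMDiffAt.comp p hu

theorem contMDiffAt_comp_coe (hr : ContDiffAt ℝ n r (u p))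
    (hu : ContMDiffAt 𝓘(ℝ, E) 𝓘(ℝ, ℝ) n u p) :
    ContMDiffAt 𝓘(ℝ, E) 𝓘(ℝ, ℝ) n (fun q ↦ r (u q)) p :=
  ContMDiffAt.comp p hr.contMDiffAt (contMDiffAt_coe hu)

theorem mfderiv_graphMap (hu : MDifferentiableAt 𝓘(ℝ, E) 𝓘(ℝ, ℝ) u p) (v : TangentSpace 𝓘(ℝ, E) p) :
    mfderiv 𝓘(ℝ, E) (𝓘(ℝ, E).prod 𝓘(ℝ, ℝ)) (graphMap u) p v =
      ((v, mvfderiv 𝓘(ℝ, E) (fun q ↦ (u q : ℝ)) p v) : E × ℝ) := by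
  rw [mvfderiv_opens_coe hu]
  exact congrArg (fun A : E →L[ℝ] E × ℝ ↦ A v)
    ((hasMFDerivAt_id (I := 𝓘(ℝ, E)) p).prodMk hu.hasMFDerivAt).mfderiv

theorem mvfderiv_neg_sq_comp {φ : M → ℝ} (hr : DifferentiableAt ℝ r (φ p))
    (hφ : MDifferentiableAt 𝓘(ℝ, E) 𝓘(ℝ, ℝ) φ p) (v : TangentSpace 𝓘(ℝ, E) p) :
    mvfderiv 𝓘(ℝ, E) (fun q ↦ -r (φ q) ^ 2) p v =
      -(2 * r (φ p) * deriv r (φ p)) * mvfderiv 𝓘(ℝ, E) φ p v := by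
  have hsq : HasDerivAt (fun t ↦ -r t ^ 2) (-(2 * r (φ p) * deriv r (φ p))) (φ p) := by
    simpa using (hr.hasDerivAt.fun_pow 2).fun_neg
  refine (mvfderiv_fderiv_comp (F := φ) hsq.differentiableAt hφ v).trans ?_
  rw [hsq.hasFDerivAt.fderiv]
  exact mul_comm _ _

variable [IsManifold 𝓘(ℝ, E) 1 M]
  (g : Bundle.ContMDiffRiemannianMetric 𝓘(ℝ, E) n E (fun x : M ↦ TangentSpace 𝓘(ℝ, E) x))

theorem gradSq_nonneg (φ : M → ℝ) (p : M) : 0 ≤ gradSq g.inner φ p := by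
  by_cases h : grad g.inner φ p = 0
  · simp [gradSq, h]
  · exact (g.pos p _ h).le

theorem graphW_sq (r : ℝ → ℝ) (u : M → J) (p : M) :
    graphW g.inner r u p ^ 2 = r (u p) ^ 2 + gradSq g.inner (fun q ↦ (u q : ℝ)) p :=
  Real.sq_sqrt (add_nonneg (sq_nonneg _) (gradSq_nonneg g _ p))

theorem graphW_pos (hr₀ : r (u p) ≠ 0) : 0 < graphW g.inner r u p :=
  Real.sqrt_pos.2 (add_pos_of_pos_of_nonneg (sq_pos_of_ne_zero hr₀) (gradSq_nonneg g _ p))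

theorem dz_graphNormal_pos (hr₀ : 0 < r (u p)) :
    0 < dz (graphMap u p) (graphNormal g.inner r u p) :=
  (div_pos hr₀ (graphW_pos g hr₀.ne')).trans_eq (dz_apply (graphMap u p) _ _).symm

/-- The downward normal field `grad u - r(u)² ∂_z` along the graph map, which is `-N` without its
normalising factor `1 / (r(u) w)`. -/
noncomputable def graphDownNormal
    (g : Π x : M, TangentSpace 𝓘(ℝ, E) x →L[ℝ] TangentSpace 𝓘(ℝ, E) x →L[ℝ] ℝ)
    (r : ℝ → ℝ) (u : M → J) (p : M) :
    TangentSpace (𝓘(ℝ, E).prod 𝓘(ℝ, ℝ)) (graphMap u p) :=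
  ((grad g (fun q ↦ (u q : ℝ)) p, -r (u p) ^ 2) : E × ℝ)

theorem graphNormal_eq_smul (hr₀ : r (u p) ≠ 0) :
    graphNormal g.inner r u p =
      (-(1 / (r (u p) * graphW g.inner r u p))) • graphDownNormal g.inner r u p := by
  have hW := (graphW_pos g hr₀).ne'
  have h : r (u p) / graphW g.inner r u p =
      -(1 / (r (u p) * graphW g.inner r u p)) * -r (u p) ^ 2 := by
    field_simp
  exact congrArg (fun t : ℝ ↦ ((_, t) : E × ℝ)) h

theorem warpedMetric_graphDownNormal_mfderiv [FiniteDimensional ℝ E] (r : ℝ → ℝ)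
    (hu : MDifferentiableAt 𝓘(ℝ, E) 𝓘(ℝ, ℝ) u p) (v : TangentSpace 𝓘(ℝ, E) p) :
    warpedMetric g.inner r (graphMap u p) (graphDownNormal g.inner r u p)
      (mfderiv 𝓘(ℝ, E) (𝓘(ℝ, E).prod 𝓘(ℝ, ℝ)) (graphMap u) p v) = 0 := by
  rw [mfderiv_graphMap hu]
  refine (warpedMetric_apply g.inner r (graphMap u p) _ _ _ _).trans ?_
  refine (congrArg (fun t ↦ r (u p) ^ 2 * t + _) (inner_grad g _ p v)).trans ?_
  ring

theorem warpedMetric_graphDownNormal_self (r : ℝ → ℝ) (u : M → J) (p : M) :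
    warpedMetric g.inner r (graphMap u p) (graphDownNormal g.inner r u p)
      (graphDownNormal g.inner r u p) = (r (u p) * graphW g.inner r u p) ^ 2 := by
  have h : r (u p) ^ 2 * gradSq g.inner (fun q ↦ (u q : ℝ)) p + -r (u p) ^ 2 * -r (u p) ^ 2 =
      (r (u p) * graphW g.inner r u p) ^ 2 := by
    rw [mul_pow, graphW_sq]
    ring
  exact (warpedMetric_apply g.inner r (graphMap u p) _ _ _ _).trans h

theorem warpedMetric_graphNormal_mfderiv [FiniteDimensional ℝ E] (hr₀ : r (u p) ≠ 0)
    (hu : MDifferentiableAt 𝓘(ℝ, E) 𝓘(ℝ, ℝ) u p) (v : TangentSpace 𝓘(ℝ, E) p) :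
    warpedMetric g.inner r (graphMap u p) (graphNormal g.inner r u p)
      (mfderiv 𝓘(ℝ, E) (𝓘(ℝ, E).prod 𝓘(ℝ, ℝ)) (graphMap u) p v) = 0 := by
  rw [graphNormal_eq_smul g hr₀, map_smul, _root_.smul_apply,
    warpedMetric_graphDownNormal_mfderiv g r hu, smul_zero]

theorem warpedMetric_graphNormal_self (hr₀ : r (u p) ≠ 0) :
    warpedMetric g.inner r (graphMap u p) (graphNormal g.inner r u p)
      (graphNormal g.inner r u p) = 1 := by
  have hW := (graphW_pos g hr₀).ne'
  rw [graphNormal_eq_smul g hr₀]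
  simp only [map_smul, _root_.smul_apply, smul_eq_mul, warpedMetric_graphDownNormal_self]
  field_simp

variable [FiniteDimensional ℝ E]

theorem contMDiffAt_graphDownNormal (hr : ContDiffAt ℝ n r (u p))
    (hu : ContMDiffAt 𝓘(ℝ, E) 𝓘(ℝ, ℝ) (n + 1) u p) :
    ContMDiffAt 𝓘(ℝ, E) (𝓘(ℝ, E).prod 𝓘(ℝ, ℝ)).tangent n
      (fun q ↦ (⟨graphMap u q, graphDownNormal g.inner r u q⟩ :
        TangentBundle (𝓘(ℝ, E).prod 𝓘(ℝ, ℝ)) (M × J))) p :=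
  have hu' := hu.of_le le_self_add
  contMDiffAt_along_prodMk (contMDiffAt_grad g (contMDiffAt_coe hu)) hu'
    ((contMDiffAt_comp_coe hr hu').pow 2).neg

theorem contMDiffAt_gradSq {φ : M → ℝ} (hφ : ContMDiffAt 𝓘(ℝ, E) 𝓘(ℝ, ℝ) (n + 1) φ p) :
    ContMDiffAt 𝓘(ℝ, E) 𝓘(ℝ, ℝ) n (gradSq g.inner φ) p :=
  have hX := contMDiffAt_grad g hφ
  (Bundle.contMDiffAt_totalSpace.1 (ContMDiffAt.clm_bundle_apply₂ (F₃ := ℝ)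
    (E₃ := Bundle.Trivial M ℝ) (g.contMDiff p) hX hX)).2

theorem contMDiffAt_inv_mul_graphW (hr₀ : r (u p) ≠ 0) (hr : ContDiffAt ℝ n r (u p))
    (hu : ContMDiffAt 𝓘(ℝ, E) 𝓘(ℝ, ℝ) (n + 1) u p) :
    ContMDiffAt 𝓘(ℝ, E) 𝓘(ℝ, ℝ) n (fun q ↦ 1 / (r (u q) * graphW g.inner r u q)) p := by
  have hru := contMDiffAt_comp_coe hr (hu.of_le le_self_add)
  have hsq := (hru.pow 2).add (contMDiffAt_gradSq g (contMDiffAt_coe hu))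
  have hW₀ := graphW_pos g hr₀
  have hW : ContMDiffAt 𝓘(ℝ, E) 𝓘(ℝ, ℝ) n (graphW g.inner r u) p :=
    ContMDiffAt.comp p (Real.contDiffAt_sqrt (Real.sqrt_pos.1 hW₀).ne').contMDiffAt hsq
  have hinv : ContDiffAt ℝ n (fun t : ℝ ↦ 1 / t) (r (u p) * graphW g.inner r u p) :=
    contDiffAt_const.div contDiffAt_id (mul_ne_zero hr₀ hW₀.ne')
  exact ContMDiffAt.comp p hinv.contMDiffAt (hru.mul hW)

end Graph

section GraphCurvature

variable {E : Type*} [NormedAddCommGroup E] [NormedSpace ℝ E] [FiniteDimensional ℝ E]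
  {M : Type*} [TopologicalSpace M] [ChartedSpace E M] [IsManifold 𝓘(ℝ, E) 1 M] {n : ℕ∞ω}
  (g : Bundle.ContMDiffRiemannianMetric 𝓘(ℝ, E) n E (fun x : M ↦ TangentSpace 𝓘(ℝ, E) x))
  {J : TopologicalSpace.Opens ℝ} {r : ℝ → ℝ} {u : M → J} {p : M}

theorem inducedMetric_graphMap (r : ℝ → ℝ) (hu : MDifferentiableAt 𝓘(ℝ, E) 𝓘(ℝ, ℝ) u p) :
    inducedMetric (I := 𝓘(ℝ, E)) (warpedMetric g.inner r) (graphMap u) p =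
      letI G : E →L[ℝ] E →L[ℝ] ℝ := g.inner p
      letI X : E := grad g.inner (fun q ↦ (u q : ℝ)) p
      r (u p) ^ 2 • G + (G X).smulRight (G X) := by
  refine ContinuousLinearMap.ext fun v ↦ ContinuousLinearMap.ext fun w ↦ ?_
  have h := warpedMetric_apply g.inner r (graphMap u p) v w
    (mvfderiv 𝓘(ℝ, E) (fun q ↦ (u q : ℝ)) p v) (mvfderiv 𝓘(ℝ, E) (fun q ↦ (u q : ℝ)) p w)
  rw [← mfderiv_graphMap hu, ← mfderiv_graphMap hu, ← inner_grad g, ← inner_grad g] at h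
  exact h

theorem secondFundamentalForm_graphDownNormal (hn : n ≠ 0) (hr₀ : r (u p) ≠ 0)
    (hr : ContDiffAt ℝ n r (u p)) (hu : ContMDiffAt 𝓘(ℝ, E) 𝓘(ℝ, ℝ) (n + 1) u p) :
    secondFundamentalForm (I := 𝓘(ℝ, E)) (warpedMetric g.inner r) (graphMap u)
        (graphDownNormal g.inner r u) p =
      letI G : E →L[ℝ] E →L[ℝ] ℝ := g.inner p
      letI X : E := grad g.inner (fun q ↦ (u q : ℝ)) p
      letI A : E →L[ℝ] E := hessianEndo g.inner (fun q ↦ (u q : ℝ)) p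
      G ∘L (-r (u p) ^ 2 • A + (2 * r (u p) * deriv r (u p)) • (G X).smulRight X +
        (r (u p) ^ 3 * deriv r (u p)) • .id ℝ E) := by
  have hr' := hr.differentiableAt hn
  have hu' := hu.mdifferentiableAt (by simp)
  have hcoe := (contMDiffAt_coe hu).mdifferentiableAt (by simp)
  let G : E →L[ℝ] E →L[ℝ] ℝ := g.inner p
  let X : E := grad g.inner (fun q ↦ (u q : ℝ)) p
  let A : E →L[ℝ] E := hessianEndo g.inner (fun q ↦ (u q : ℝ)) p
  let du : E →L[ℝ] ℝ := mvfderiv 𝓘(ℝ, E) (fun q ↦ (u q : ℝ)) p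
  let dφ : E →L[ℝ] ℝ := mvfderiv 𝓘(ℝ, E) (fun q ↦ -r (u q) ^ 2) p
  have hG (v w : E) : -(r (u p) ^ 2 * G (A v) w + dφ v * du w + r (u p) * deriv r (u p) *
      (du v * G X w + -r (u p) ^ 2 * G v w - du w * G v X)) =
      (G ∘L (-r (u p) ^ 2 • A + (2 * r (u p) * deriv r (u p)) • (G X).smulRight X +
        (r (u p) ^ 3 * deriv r (u p)) • .id ℝ E)) v w := by
    have hdu (w : E) : du w = G X w := (inner_grad g _ p w).symm
    have hdφ : dφ v = -(2 * r (u p) * deriv r (u p)) * du v :=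
      mvfderiv_neg_sq_comp (φ := fun q ↦ (u q : ℝ)) hr' hcoe v
    have hsymm : G v X = G X v := g.symm p v X
    simp only [hdφ, hdu, hsymm, ContinuousLinearMap.comp_apply, map_add, map_smul,
      _root_.add_apply, _root_.smul_apply, ContinuousLinearMap.smulRight_apply,
      ContinuousLinearMap.id_apply, smul_eq_mul]
    ring
  refine ContinuousLinearMap.ext fun v ↦ ContinuousLinearMap.ext fun w ↦ ?_
  have hconn := warpedMetric_covDerivAlong (g := g.inner) (f₁ := fun q ↦ q) (f₂ := u)
    (X := grad g.inner fun q ↦ (u q : ℝ)) (φ := fun q ↦ -r (u q) ^ 2) (p := p) (g.pos p)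
    ((contMDiffAt_metricCoeff g p).mdifferentiableAt hn) hr₀ hr'
    ((contMDiffAt_grad g (contMDiffAt_coe hu)).mdifferentiableAt hn) hu'
    (((contMDiffAt_comp_coe hr (hu.of_le le_self_add)).pow 2).neg.mdifferentiableAt hn) v w (du w)
  have hid : mfderiv 𝓘(ℝ, E) 𝓘(ℝ, E) (fun q : M ↦ q) p v = v :=
    congrArg (fun B : E →L[ℝ] E ↦ B v) mfderiv_id
  rw [hid] at hconn
  rw [secondFundamentalForm_apply, mfderiv_graphMap hu']
  exact (congrArg Neg.neg hconn).trans (hG v w)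

theorem meanCurvature_graphDownNormal (hn : n ≠ 0) (hr₀ : r (u p) ≠ 0)
    (hr : ContDiffAt ℝ n r (u p)) (hu : ContMDiffAt 𝓘(ℝ, E) 𝓘(ℝ, ℝ) (n + 1) u p) :
    meanCurvature 𝓘(ℝ, E) (warpedMetric g.inner r) (graphMap u) (graphDownNormal g.inner r u) p =
      -laplacian g.inner (fun q ↦ (u q : ℝ)) p +
        (1 / 2 * g.inner p (grad g.inner (gradSq g.inner (fun q ↦ (u q : ℝ))) p)
            (grad g.inner (fun q ↦ (u q : ℝ)) p) +
          r (u p) * deriv r (u p) * gradSq g.inner (fun q ↦ (u q : ℝ)) p) /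
            graphW g.inner r u p ^ 2 +
        Module.finrank ℝ E * (r (u p) * deriv r (u p)) := by
  let G : E →L[ℝ] E →L[ℝ] ℝ := g.inner p
  let X : E := grad g.inner (fun q ↦ (u q : ℝ)) p
  let A : E →L[ℝ] E := hessianEndo g.inner (fun q ↦ (u q : ℝ)) p
  let Q := gradSq g.inner (fun q ↦ (u q : ℝ)) p
  have hW : r (u p) ^ 2 + Q = graphW g.inner r u p ^ 2 := (graphW_sq g r u p).symm
  have hW₀ : r (u p) ^ 2 + Q ≠ 0 := hW ▸ pow_ne_zero 2 (graphW_pos g hr₀).ne'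
  have hHess : g.inner p (grad g.inner (gradSq g.inner fun q ↦ (u q : ℝ)) p) X =
      2 * G X (A X) := by
    rw [inner_grad, mvfderiv_gradSq g hn (contMDiffAt_coe hu)]
    exact congrArg (2 * ·) (g.symm p _ _)
  have hcurv : meanCurvature 𝓘(ℝ, E) (warpedMetric g.inner r) (graphMap u)
      (graphDownNormal g.inner r u) p = (r (u p) ^ 2)⁻¹ * (-r (u p) ^ 2 *
        (laplacian g.inner (fun q ↦ (u q : ℝ)) p - G X (A X) / (r (u p) ^ 2 + Q)) +
        2 * r (u p) * deriv r (u p) * r (u p) ^ 2 * (Q / (r (u p) ^ 2 + Q)) +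
        r (u p) ^ 3 * deriv r (u p) * (Module.finrank ℝ E - Q / (r (u p) ^ 2 + Q))) := by
    rw [meanCurvature, secondFundamentalForm_graphDownNormal g hn hr₀ hr hu,
      inducedMetric_graphMap g r (hu.mdifferentiableAt (by simp))]
    exact metricTrace_smul_add_smulRight_comp_add (G := G) (isInvertible_inner g p) X
      (pow_ne_zero 2 hr₀) hW₀ A _ _ _
  rw [hcurv, hHess, ← hW]
  field_simp
  ring

end GraphCurvature

section SmoothGraph

variable {E : Type*} [NormedAddCommGroup E] [NormedSpace ℝ E] [FiniteDimensional ℝ E]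
  {M : Type*} [TopologicalSpace M] [ChartedSpace E M] [IsManifold 𝓘(ℝ, E) 1 M] {n : ℕ∞ω}
  (g : Bundle.ContMDiffRiemannianMetric 𝓘(ℝ, E) n E (fun x : M ↦ TangentSpace 𝓘(ℝ, E) x))
  {J : TopologicalSpace.Opens ℝ} {r : ℝ → ℝ} {u : M → J} {p : M}

theorem contMDiffAt_graphNormal (hr₀ : ∀ z ∈ J, r z ≠ 0) (hr : ContDiffAt ℝ n r (u p))
    (hu : ContMDiffAt 𝓘(ℝ, E) 𝓘(ℝ, ℝ) (n + 1) u p) :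
    ContMDiffAt 𝓘(ℝ, E) (𝓘(ℝ, E).prod 𝓘(ℝ, ℝ)).tangent n
      (fun q ↦ (⟨graphMap u q, graphNormal g.inner r u q⟩ :
        TangentBundle (𝓘(ℝ, E).prod 𝓘(ℝ, ℝ)) (M × J))) p := by
  have hu' := hu.of_le le_self_add
  have hc := (contMDiffAt_inv_mul_graphW g (hr₀ _ (u p).2) hr hu).neg
  simp only [graphNormal_eq_smul g (hr₀ _ (u _).2)]
  exact contMDiffAt_along_prodMk (hc.smul_section (contMDiffAt_grad g (contMDiffAt_coe hu))) hu'
    (hc.mul ((contMDiffAt_comp_coe hr hu').pow 2).neg)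

theorem meanCurvature_neg_graphNormal (hn : n ≠ 0) (hr₀ : ∀ z ∈ J, r z ≠ 0)
    (hr : ContDiffAt ℝ n r (u p)) (hu : ContMDiffAt 𝓘(ℝ, E) 𝓘(ℝ, ℝ) (n + 1) u p) :
    meanCurvature 𝓘(ℝ, E) (warpedMetric g.inner r) (graphMap u)
        (fun q ↦ -graphNormal g.inner r u q) p =
      1 / (r (u p) * graphW g.inner r u p) *
        meanCurvature 𝓘(ℝ, E) (warpedMetric g.inner r) (graphMap u)
          (graphDownNormal g.inner r u) p := by
  have hu' := hu.mdifferentiableAt (by simp)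
  simp only [graphNormal_eq_smul g (hr₀ _ (u _).2), neg_smul, neg_neg]
  exact meanCurvature_smul
    ((contMDiffAt_inv_mul_graphW g (hr₀ _ (u p).2) hr hu).mdifferentiableAt hn)
    ((contMDiffAt_graphDownNormal g hr hu).mdifferentiableAt hn)
    (warpedMetric_graphDownNormal_mfderiv g r hu')

end SmoothGraph

theorem lemma2p2_general {E : Type*} [NormedAddCommGroup E] [NormedSpace ℝ E]
    [FiniteDimensional ℝ E] {M : Type*} [TopologicalSpace M] [ChartedSpace E M]
    [IsManifold 𝓘(ℝ, E) ∞ M]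
    (g : Bundle.ContMDiffRiemannianMetric 𝓘(ℝ, E) ∞ E (fun x : M ↦ TangentSpace 𝓘(ℝ, E) x))
    (J : TopologicalSpace.Opens ℝ)
    (r : ℝ → ℝ) (hr : ContDiffOn ℝ ∞ r J) (hr_pos : ∀ z ∈ J, 0 < r z)
    (u : M → J) (hu : ContMDiff 𝓘(ℝ, E) 𝓘(ℝ, ℝ) ∞ u) :
    IsUnitNormalAlong 𝓘(ℝ, E) (warpedMetric g.inner r) (graphMap u) (graphNormal g.inner r u) ∧
      (∀ p, 0 < dz (graphMap u p) (graphNormal g.inner r u p)) ∧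
      ∀ p, meanCurvature 𝓘(ℝ, E) (warpedMetric g.inner r) (graphMap u)
          (fun q ↦ -graphNormal g.inner r u q) p =
        -(1 / (r (u p) * graphW g.inner r u p)) * laplacian g.inner (fun q ↦ (u q : ℝ)) p
          + 1 / (2 * r (u p) * graphW g.inner r u p ^ 3) *
              g.inner p (grad g.inner (gradSq g.inner (fun q ↦ (u q : ℝ))) p)
                (grad g.inner (fun q ↦ (u q : ℝ)) p)
          + deriv r (u p) / graphW g.inner r u p ^ 3 * gradSq g.inner (fun q ↦ (u q : ℝ)) p
          + Module.finrank ℝ E * (deriv r (u p) / graphW g.inner r u p) := by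
  have hr' (p : M) : ContDiffAt ℝ ∞ r (u p) := hr.contDiffAt (J.isOpen.mem_nhds (u p).2)
  have hr₀ (z : ℝ) (hz : z ∈ J) : r z ≠ 0 := (hr_pos z hz).ne'
  refine ⟨⟨fun p ↦ contMDiffAt_graphNormal g hr₀ (hr' p) (hu p),
    fun p ↦ warpedMetric_graphNormal_self g (hr₀ _ (u p).2),
    fun p ↦ warpedMetric_graphNormal_mfderiv g (hr₀ _ (u p).2)
      ((hu p).mdifferentiableAt (by simp))⟩,
    fun p ↦ dz_graphNormal_pos g (hr_pos _ (u p).2), fun p ↦ ?_⟩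
  have hup := hr₀ _ (u p).2
  have hW := (graphW_pos g hup).ne'
  rw [meanCurvature_neg_graphNormal g (by simp) hr₀ (hr' p) (hu p),
    meanCurvature_graphDownNormal g (by simp) hup (hr' p) (hu p)]
  field_simp
  ring

end WarpedGraph

open WarpedGraph in
theorem lemma2p2 (n : ℕ) {M : Type*} [TopologicalSpace M] [T2Space M] [CompactSpace M]
    [ChartedSpace (EuclideanSpace ℝ (Fin n)) M]
    [IsManifold 𝓘(ℝ, EuclideanSpace ℝ (Fin n)) ∞ M]
    (g : Bundle.ContMDiffRiemannianMetric 𝓘(ℝ, EuclideanSpace ℝ (Fin n)) ∞ (EuclideanSpace ℝ (Fin n))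
      (fun x : M ↦ TangentSpace 𝓘(ℝ, EuclideanSpace ℝ (Fin n)) x))
    (J : TopologicalSpace.Opens ℝ) (hJ : (J : Set ℝ).OrdConnected)
    (r : ℝ → ℝ) (hr : ContDiffOn ℝ ∞ r J) (hr_pos : ∀ z ∈ J, 0 < r z)
    (u : M → J) (hu : ContMDiff 𝓘(ℝ, EuclideanSpace ℝ (Fin n)) 𝓘(ℝ, ℝ) ∞ u) :
    IsUnitNormalAlong 𝓘(ℝ, EuclideanSpace ℝ (Fin n)) (warpedMetric g.inner r) (graphMap u)
        (graphNormal g.inner r u) ∧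
      (∀ p, 0 < dz (graphMap u p) (graphNormal g.inner r u p)) ∧
      ∀ p, meanCurvature 𝓘(ℝ, EuclideanSpace ℝ (Fin n)) (warpedMetric g.inner r) (graphMap u)
          (fun q ↦ -graphNormal g.inner r u q) p =
        -(1 / (r (u p) * graphW g.inner r u p)) * laplacian g.inner (fun q ↦ (u q : ℝ)) p
          + 1 / (2 * r (u p) * graphW g.inner r u p ^ 3) *
              g.inner p (grad g.inner (gradSq g.inner (fun q ↦ (u q : ℝ))) p)
                (grad g.inner (fun q ↦ (u q : ℝ)) p)
          + deriv r (u p) / graphW g.inner r u p ^ 3 * gradSq g.inner (fun q ↦ (u q : ℝ)) p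
          + n * (deriv r (u p) / graphW g.inner r u p) := by
  simpa only [finrank_euclideanSpace_fin] using lemma2p2_general g J r hr hr_pos u hu
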